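/- **Definitions.** Fix a field $\Bbbk$. Let $K$ be a finite abstract simplicial complex. A *filter function* on $K$ is a function $f:K\to\mathbb R$ with $f(\sigma)\le f(\sigma')$ whenever $\sigma\subseteq\sigma'$; then $K^t=\{\sigma\in K: f(\sigma)\le t\}$ is a subcomplex for every $t\in\mathbb R$. For $p\in\mathbb N$ let $\mathbf H_p(f)$ be the persistence module (functor from $(\mathbb R,\le)$ to $\Bbbk$-vector spaces) $t\mapsto H_p(K^t;\Bbbk)$ (simplicial homology), with the maps induced by inclusions. A *barcode* is a multiset $B\cup\Delta^\infty$, where $B$ is a finite multiset of points of $\mathbb R\times(\mathbb R\cup\{+\infty\})$ and $\Delta^\infty$ consists of countably many copies of the diagonal $\{(b,b):b\in\mathbb R\}$; $Bar$ is the set of barcodes. If $\mathbf H_p(f)\cong\bigoplus_{J\in\mathcal J}\mathbb I_J$ for a finite multiset $\mathcal J$ of nonempty intervals of $\mathbb R$ bounded below, where $\mathbb I_J$ is the interval module of $J$, then $\mathrm{Dgm}_p(f)=\{(\inf J,\sup J)\}_{J\in\mathcal J}\cup\Delta^\infty$. For $m,n\in\mathbb N$ let $Q_{m,n}:\mathbb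 R^{2m}\times\mathbb R^n\to Bar$ be the map $$(b_1,d_1,\dots,b_m,d_m,v_1,\dots,v_n)\mapsto\{(b_i,d_i)\}_{i=1}^m\cup\{(v_j,+\infty)\}_{j=1}^n\cup\Delta^\infty .$$ Let $M$ be a smooth finite-dimensional manifold without boundary and $r\in\mathbb N\cup\{+\infty\}$. A map $B:M\to Bar$ is *$r$-differentiable at $x\in M$* if there are an open neighborhood $W$ of $x$, integers $m,n\in\mathbb N$ and a map $\tilde B:W\to\mathbb R^{2m}\times\mathbb R^n$ of class $C^r$ with $B=Q_{m,n}\circ\tilde B$ on $W$. Two filter functions $f,g$ on $K$ are *ordering equivalent*, $f\sim g$, if they induce the same pre-order on the simplices: $f(\sigma)\le f(\sigma')\iff g(\sigma)\le g(\sigma')$ for all $\sigma,\sigma'\in K$. **Theorem (Global discrete smoothness).** Let $F:M\to\mathbb R^K$ be a continuous map such that $F(x)$ is a filter function for every $x\in M$, let $U\subseteq M$ be open, let $r\in\mathbb N\cup\{+\infty\}$, and suppose that $F$ is of class $C^r$ on $U$. Let $p\in\mathbb N$. Then $\mathrm{Dgm}_p(F(x))$ exists and is unique for every $x\in M$; let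 $B_p:M\to Bar$, $B_p(x)=\mathrm{Dgm}_p(F(x))$. Put $$\tilde M=\{x\in M:\ \text{there is an open neighborhood } U_x \text{ of } x \text{ with } F(x')\sim F(x)\text{ for all }x'\in U_x\}.$$ Then $\tilde M$ is open and dense in $M$, and $B_p$ is $r$-differentiable at every point of $U\cap\tilde M$. In particular, if $U$ is moreover dense in $M$, then there is an open dense subset $G\subseteq U$ of $M$ such that $B_p$ is $r$-differentiable at every point of $G$. -/

import Mathlib

open CategoryTheory Set Topology
open scoped Manifold ContDiff

universe u v w

set_option maxSynthPendingDepth 3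

namespace BarcodeSmoothness

noncomputable section

/-! ### Persistence modules and interval decompositions -/

/-- A persistence module over the field `k`: a functor from the poset `(ℝ, ≤)` to `k`-vector
spaces. -/
abbrev PersistenceModule (k : Type u) [Field k] := ℝ ⥤ ModuleCat.{w} k

/-- A (nonempty, possibly unbounded, open, closed or half-open) interval of the real line. -/
structure RealInterval where
  carrier : Set ℝ
  nonempty : carrier.Nonempty
  ordConnected : carrier.OrdConnected

/-- The space at `t` of the interval module of `J`: a copy of `k` if `t ∈ J`, and `0` otherwise. -/
def intervalSpace (k : Type u) [Field k] (J : RealInterval) (t : ℝ) :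
    Submodule k (ULift.{w} k) :=
  open Classical in if t ∈ J.carrier then ⊤ else ⊥

/-- The structure map of the interval module of `J` into its space at `t`: the identity on the
copies of `k` if `t ∈ J`, and `0` otherwise. -/
def intervalMap (k : Type u) [Field k] (J : RealInterval) (s t : ℝ) :
    intervalSpace.{u, w} k J s →ₗ[k] intervalSpace.{u, w} k J t :=
  LinearMap.restrict (open Classical in if t ∈ J.carrier then LinearMap.id else 0) (by
    intro c _
    by_cases ht : t ∈ J.carrier <;> simp [intervalSpace, ht])

/-- The interval module of `J`. -/
def intervalModule (k : Type u) [Field k] (J : RealInterval) :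
    PersistenceModule.{u, max u w} k where
  obj t := ModuleCat.of k (intervalSpace.{u, w} k J t)
  map {s t} _ := ModuleCat.ofHom (intervalMap.{u, w} k J s t)
  map_id t := by
    ext ⟨c, hc⟩
    by_cases ht : t ∈ J.carrier
    · simp [intervalMap, ht]
    · simp only [intervalSpace, ht, if_false, Submodule.mem_bot] at hc
      simp [intervalMap, ht, hc]
  map_comp {q s t} f g := by
    ext ⟨c, hc⟩
    by_cases hq : q ∈ J.carrier
    · by_cases ht : t ∈ J.carrier
      · have hs : s ∈ J.carrier := J.ordConnected.out hq ht ⟨leOfHom f, leOfHom g⟩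
        simp [intervalMap, ht, hs]
      · simp [intervalMap, ht]
    · simp only [intervalSpace, hq, if_false, Submodule.mem_bot] at hc
      simp [intervalMap, hc]

/-- The direct sum of a finite family of persistence modules, computed pointwise. -/
def directSum {k : Type u} [Field k] {n : ℕ} (W : Fin n → PersistenceModule.{u, w} k) :
    PersistenceModule.{u, w} k where
  obj t := ModuleCat.of k (∀ i, (W i).obj t)
  map f := ModuleCat.ofHom (LinearMap.pi fun i => ((W i).map f).hom ∘ₗ LinearMap.proj i)
  map_id t := by ext x; simp
  map_comp f g := by ext x; simp

/-! ### Persistence diagrams -/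

/-- The multiplicity function of the multiset `B ∪ Δ^∞`, where `Δ^∞` consists of countably many
copies of the diagonal. -/
def withDiagonal (B : Multiset (ℝ × WithTop ℝ)) (x : ℝ × WithTop ℝ) : ℕ∞ :=
  open Classical in (B.count x : ℕ∞) + if x.2 = (x.1 : WithTop ℝ) then ⊤ else 0

/-- The set of persistence diagrams (barcodes): multisets of the form `B ∪ Δ^∞`, where `B` is a
finite multiset of points of `ℝ × (ℝ ∪ {+∞})`. -/
def Bar : Type :=
  {D : ℝ × WithTop ℝ → ℕ∞ // ∃ B : Multiset (ℝ × WithTop ℝ), D = withDiagonal B}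

/-- The persistence diagram `B ∪ Δ^∞`. -/
def Bar.ofMultiset (B : Multiset (ℝ × WithTop ℝ)) : Bar := ⟨withDiagonal B, B, rfl⟩

/-- The point `(inf J, sup J)` (for `J` bounded below). -/
def RealInterval.endpoints (J : RealInterval) : ℝ × WithTop ℝ :=
  open Classical in
  (sInf J.carrier, if BddAbove J.carrier then ((sSup J.carrier : ℝ) : WithTop ℝ) else ⊤)

/-- `D` is the persistence diagram of `𝕍`: the module `𝕍` is isomorphic to a finite direct sum of
interval modules, and `D` is the multiset of the pairs of endpoints of these intervals, together
with `Δ^∞`. -/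
def IsDiagramOf {k : Type u} [Field k] (𝕍 : PersistenceModule.{u, max u w} k) (D : Bar) : Prop :=
  ∃ (n : ℕ) (J : Fin n → RealInterval),
    (∀ i, BddBelow (J i).carrier) ∧
    Nonempty (𝕍 ≅ directSum fun i => intervalModule.{u, w} k (J i)) ∧
    D = Bar.ofMultiset (Finset.univ.val.map fun i => (J i).endpoints)

/-! ### Simplicial homology with coefficients in a field

The vertices are totally ordered, and a `p`-simplex is written as the strictly increasing tuple of
its `p + 1` vertices. -/

section Homology

variable (k : Type u) [Field k] {V : Type v}

/-- The simplicial boundary in positive degrees: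
`[v₀, …, v_{p+1}] ↦ ∑ i, (-1)^i [v₀, …, v̂ᵢ, …, v_{p+1}]`. -/
def boundary (V : Type v) (p : ℕ) :
    ((Fin (p + 2) → V) →₀ k) →ₗ[k] ((Fin (p + 1) → V) →₀ k) :=
  ∑ i : Fin (p + 2), (-1 : k) ^ (i : ℕ) • Finsupp.lmapDomain k k fun v => v ∘ i.succAbove

theorem boundary_single (p : ℕ) (v : Fin (p + 2) → V) (a : k) :
    boundary k V p (Finsupp.single v a) =
      ∑ i : Fin (p + 2), (-1 : k) ^ (i : ℕ) • Finsupp.single (v ∘ i.succAbove) a := by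
  simp [boundary, LinearMap.sum_apply, Finsupp.mapDomain_single]

theorem boundary_boundary (p : ℕ) (c : (Fin (p + 3) → V) →₀ k) :
    boundary k V p (boundary k V (p + 1) c) = 0 := by
  induction c using Finsupp.induction_linear with
  | zero => simp
  | add c d hc hd => simp [hc, hd]
  | single v a =>
    simp only [boundary_single, map_sum, map_smul, Finset.smul_sum, smul_smul, ← pow_add]
    rw [← Finset.sum_product', Finset.univ_product_univ]
    refine Finset.sum_involution (fun ij _ => (ij.1.succAbove ij.2, ij.2.predAbove ij.1))
      ?_ ?_ ?_ ?_
    · rintro ⟨i, j⟩ -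
      have hpow : (-1 : k) ^ ((i.succAbove j : Fin (p + 3)) + (j.predAbove i : Fin (p + 2)) : ℕ) =
          -(-1 : k) ^ ((i : ℕ) + j) := by
        rcases lt_or_ge j.castSucc i with h | h
        · rw [Fin.succAbove_of_castSucc_lt _ _ h, Fin.predAbove_of_castSucc_lt _ _ h]
          obtain ⟨m, hm⟩ : ∃ m, (i : ℕ) = m + 1 :=
            ⟨i - 1, by have : (j : ℕ) < i := h; omega⟩
          simp only [Fin.val_castSucc, Fin.val_pred, hm, Nat.add_sub_cancel]
          ring
        · rw [Fin.succAbove_of_le_castSucc _ _ h, Fin.predAbove_of_le_castSucc _ _ h]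
          simp only [Fin.val_succ, Fin.coe_castPred]
          ring
      have hcomp : (v ∘ (i.succAbove j).succAbove) ∘ (j.predAbove i).succAbove =
          (v ∘ i.succAbove) ∘ j.succAbove := by
        funext l
        simp only [Function.comp]
        rw [Fin.succAbove_succAbove_succAbove_predAbove]
      simp only [hpow, hcomp, neg_smul, add_neg_cancel]
    · rintro ⟨i, j⟩ - - h
      exact Fin.succAbove_ne i j (congrArg Prod.fst h)
    · intros; exact Finset.mem_univ _
    · rintro ⟨i, j⟩ -
      simp [Fin.succAbove_succAbove_predAbove, Fin.predAbove_predAbove_succAbove]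

variable [LinearOrder V]

/-- The simplicial `p`-chains of `K`: the span of the `p`-simplices of `K`, inside the free vector
space on all `(p + 1)`-tuples of vertices. -/
def chains (K : PreAbstractSimplicialComplex V) (p : ℕ) : Submodule k ((Fin (p + 1) → V) →₀ k) :=
  Submodule.span k
    {c | ∃ v : Fin (p + 1) → V, StrictMono v ∧ Finset.univ.image v ∈ K.faces ∧
      c = Finsupp.single v 1}

/-- The simplicial `p`-cycles of `K`; every `0`-chain is a cycle. -/
def cycles (K : PreAbstractSimplicialComplex V) : ∀ p : ℕ, Submodule k ((Fin (p + 1) → V) →₀ k)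
  | 0 => chains k K 0
  | p + 1 => chains k K (p + 1) ⊓ LinearMap.ker (boundary k V p)

/-- The simplicial `p`-boundaries of `K`. -/
def boundaries (K : PreAbstractSimplicialComplex V) (p : ℕ) :
    Submodule k ((Fin (p + 1) → V) →₀ k) :=
  (chains k K (p + 1)).map (boundary k V p)

/-- The simplicial homology of `K` in degree `p`: cycles modulo boundaries. -/
abbrev homology (K : PreAbstractSimplicialComplex V) (p : ℕ) : Type (max u v) :=
  cycles k K p ⧸ (boundaries k K p).comap (cycles k K p).subtype

theorem boundary_mem_chains {K : PreAbstractSimplicialComplex V} {p : ℕ}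
    {c : (Fin (p + 2) → V) →₀ k} (hc : c ∈ chains k K (p + 1)) :
    boundary k V p c ∈ chains k K p := by
  suffices h : chains k K (p + 1) ≤ (chains k K p).comap (boundary k V p) from h hc
  refine Submodule.span_le.2 ?_
  rintro _ ⟨v, hv, hvK, rfl⟩
  simp only [Submodule.comap_coe, Set.mem_preimage, SetLike.mem_coe, boundary_single]
  refine Submodule.sum_mem _ fun i _ => Submodule.smul_mem _ _ (Submodule.subset_span ?_)
  refine ⟨_, hv.comp i.strictMono_succAbove, ?_, rfl⟩
  refine (K.isRelLowerSet_faces hvK).2 ?_ (Finset.univ_nonempty.image _)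
  intro x hx
  simp only [Finset.mem_image, Finset.mem_univ, true_and, Function.comp] at hx ⊢
  obtain ⟨j, rfl⟩ := hx
  exact ⟨_, rfl⟩

/-- Boundaries are cycles. -/
theorem boundaries_le_cycles (K : PreAbstractSimplicialComplex V) (p : ℕ) :
    boundaries k K p ≤ cycles k K p := by
  rintro _ ⟨c, hc, rfl⟩
  cases p with
  | zero => exact boundary_mem_chains k hc
  | succ p => exact ⟨boundary_mem_chains k hc, boundary_boundary k p c⟩

variable {K L : PreAbstractSimplicialComplex V}

theorem chains_mono (h : K ≤ L) (p : ℕ) : chains k K p ≤ chains k L p :=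
  Submodule.span_mono fun _ ⟨v, hv, hvK, hc⟩ => ⟨v, hv, h hvK, hc⟩

theorem cycles_mono (h : K ≤ L) (p : ℕ) : cycles k K p ≤ cycles k L p := by
  cases p with
  | zero => exact chains_mono k h 0
  | succ p => exact inf_le_inf_right _ (chains_mono k h (p + 1))

theorem boundaries_mono (h : K ≤ L) (p : ℕ) : boundaries k K p ≤ boundaries k L p :=
  Submodule.map_mono (chains_mono k h (p + 1))

/-- The map induced in homology by the inclusion of a subcomplex `K` into `L`. -/
def homologyMap (h : K ≤ L) (p : ℕ) : homology k K p →ₗ[k] homology k L p :=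
  Submodule.mapQ _ _ (Submodule.inclusion (cycles_mono k h p)) fun _ hz =>
    boundaries_mono k h p hz

end Homology

/-! ### Filter functions and their persistence diagrams -/

section Filter

variable {V : Type v} {K : PreAbstractSimplicialComplex V}

/-- A filter function on `K`: a real function on the simplices of `K` that is monotone with respect
to inclusions of faces. -/
def IsFilterFunction (f : K.faces → ℝ) : Prop :=
  ∀ σ τ : K.faces, (σ : Finset V) ⊆ τ → f σ ≤ f τ

/-- The sublevel complex `K^t` of a filter function `f`, whose simplices are the simplices `σ` of
`K` with `f σ ≤ t`. -/
def sublevel (f : K.faces → ℝ) (hf : IsFilterFunction f) (t : ℝ) :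
    PreAbstractSimplicialComplex V where
  faces := {σ | ∃ h : σ ∈ K.faces, f ⟨σ, h⟩ ≤ t}
  isRelLowerSet_faces := by
    rintro σ ⟨hσ, hσt⟩
    refine ⟨(K.isRelLowerSet_faces hσ).1, fun τ hτσ hτ => ?_⟩
    have hτK : τ ∈ K.faces := (K.isRelLowerSet_faces hσ).2 hτσ hτ
    exact ⟨hτK, (hf ⟨τ, hτK⟩ ⟨σ, hσ⟩ hτσ).trans hσt⟩

theorem sublevel_mono (f : K.faces → ℝ) (hf : IsFilterFunction f) {s t : ℝ} (h : s ≤ t) :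
    sublevel f hf s ≤ sublevel f hf t :=
  fun _ ⟨hσ, hσs⟩ => ⟨hσ, hσs.trans h⟩

/-- The persistent homology module `H_p(f)` of a filter function `f`: the homology spaces
`H_p(K^t)`, with the maps induced by the inclusions `K^s ⊆ K^t`. -/
def persistentHomology (k : Type u) [Field k] [LinearOrder V] (f : K.faces → ℝ) (hf : IsFilterFunction f)
    (p : ℕ) : PersistenceModule.{u, max u v} k where
  obj t := ModuleCat.of k (homology k (sublevel f hf t) p)
  map g := ModuleCat.ofHom (homologyMap k (sublevel_mono f hf (leOfHom g)) p)
  map_id t := by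
    ext x
    rfl
  map_comp f g := by
    ext x
    rfl

/-- `D` is the persistence diagram in degree `p` of the filter function `f`. -/
def IsDgm (k : Type u) [Field k] [LinearOrder V] (f : K.faces → ℝ) (hf : IsFilterFunction f) (p : ℕ)
    (D : Bar) : Prop :=
  IsDiagramOf.{u, v} (persistentHomology k f hf p) D

/-- The persistence diagram `Dgm_p(f)` of a filter function `f`. -/
def Dgm (k : Type u) [Field k] [LinearOrder V] (f : K.faces → ℝ) (hf : IsFilterFunction f) (p : ℕ) : Bar :=
  open Classical in
  if h : ∃ D, IsDgm k f hf p D then h.choose else Bar.ofMultiset 0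

/-- Ordering equivalence `f ∼ g`: both functions induce the same pre-order on the simplices. -/
def OrderingEquivalent (f g : K.faces → ℝ) : Prop :=
  ∀ σ τ : K.faces, f σ ≤ f τ ↔ g σ ≤ g τ

/-- The set of the parameters around which the pre-order induced on the simplices is locally
constant. -/
def locallyConstantOrder {M : Type*} [TopologicalSpace M] (F : M → K.faces → ℝ) : Set M :=
  {x | ∃ W : Set M, IsOpen W ∧ x ∈ W ∧ ∀ y ∈ W, OrderingEquivalent (F y) (F x)}

end Filter

/-! ### Differentiability of barcode valued maps -/

/-- The space `ℝ^{2m} × ℝ^n` of ordered barcodes; the coordinates `(i, 0)` and `(i, 1)` of the first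
component are the two endpoints of the `i`-th finite bar. -/
abbrev OrderedBarcode (m n : ℕ) :=
  EuclideanSpace ℝ (Fin m × Fin 2) × EuclideanSpace ℝ (Fin n)

/-- The quotient map
`(b, d, v) ↦ {(bᵢ, dᵢ)}ᵢ ∪ {(vⱼ, +∞)}ⱼ ∪ Δ^∞` from ordered barcodes to barcodes. -/
def quotientMap (m n : ℕ) (x : OrderedBarcode m n) : Bar :=
  Bar.ofMultiset
    ((Finset.univ.val.map fun i : Fin m => (x.1 (i, 0), ((x.1 (i, 1) : ℝ) : WithTop ℝ))) +
      (Finset.univ.val.map fun j : Fin n => (x.2 j, (⊤ : WithTop ℝ))))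

/-- A barcode valued map `B` on a manifold is `r`-differentiable at `x` if it has a lift of class
`C^r` to a space of ordered barcodes, on an open neighborhood of `x`. -/
def RDifferentiableAt {E : Type*} [NormedAddCommGroup E] [NormedSpace ℝ E]
    {M : Type*} [TopologicalSpace M] [ChartedSpace E M]
    (r : ℕ∞) (B : M → Bar) (x : M) : Prop :=
  ∃ W : Set M, IsOpen W ∧ x ∈ W ∧ ∃ (m n : ℕ) (L : M → OrderedBarcode m n),
    ContMDiffOn 𝓘(ℝ, E) 𝓘(ℝ, OrderedBarcode m n) r L W ∧
    ∀ y ∈ W, B y = quotientMap m n (L y)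

end

end BarcodeSmoothness

/-! The combinatorics of a filtration depends only on the pre-order that the filter function induces
on simplices: replacing `f` by an equivalent `g` moves the times at which the complexes change, not
the complexes themselves. So near a point where the pre-order is locally constant, the bars are born
and die at fixed simplices, and their endpoints are the values of `F` there. The barcode then lifts
locally to a fixed linear map applied to `F`, which is as smooth as `F` (`exists_simplices_isDgm`,
`rDifferentiableAt_dgm`).

The fixed simplices come from linear algebra. The cycles of the sublevel complexes form one flag in
the chains of `K`, the boundaries another, and two flags have a common adapted basis
(`exists_linearIndependent_adapted`). Each basis vector becomes a cycle at one simplex and possibly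
a boundary at another, or is never a cycle; those that spend time as a cycle but not a boundary give
the interval summands (`nonempty_persistentHomology_iso`). This proves existence of the diagram for
every filter function.

Uniqueness (`IsDiagramOf.unique`) rests on ranks of structure maps: they count the intervals
containing two given parameters, and these counts determine the off-diagonal endpoints.

Density is a maximality argument: in a nonempty open set, take a point with a maximal set of strict
inequalities between simplex values. These persist nearby, and no new ones can appear
(`dense_locallyConstantOrder`). -/

namespace BarcodeSmoothness

/-! ### Bases adapted to two flags -/

section Flags

variable {k W : Type*} [Field k] [AddCommGroup W] [Module k W]

/-- Every nonzero finite-dimensional `H` has a hyperplane, the kernel of a linear form, that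
contains the traces on `H` of all members of a given flag that do not contain `H`. -/
theorem exists_hyperplane_of_isChain {S : Set (Submodule k W)} (hS : IsChain (· ≤ ·) S)
    (H : Submodule k W) [FiniteDimensional k H] (hH : H ≠ ⊥) :
    ∃ ψ : W →ₗ[k] k, (∃ x ∈ H, ψ x ≠ 0) ∧
      ∀ A ∈ S, H ≤ A ∨ A ⊓ H ≤ LinearMap.ker ψ := by
  suffices h : ∃ N : Submodule k W, N < H ∧ ∀ A ∈ S, H ≤ A ∨ A ⊓ H ≤ N by
    obtain ⟨N, hN, hA⟩ := h
    obtain ⟨x, hxH, hxN⟩ := SetLike.exists_of_lt hN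
    obtain ⟨ψ, hψ, hker⟩ := Submodule.exists_le_ker_of_notMem hxN
    exact ⟨ψ, ⟨x, hxH, hψ⟩, fun A hAS => (hA A hAS).imp_right fun h => h.trans hker⟩
  by_cases hex : ∃ A, A ∈ S ∧ ¬ H ≤ A
  · obtain ⟨A, ⟨hAS, hAH⟩, hmin⟩ := exists_minimalFor_of_wellFoundedLT
      (fun A => A ∈ S ∧ ¬ H ≤ A)
      (fun A => Module.finrank k H - Module.finrank k (A ⊓ H : Submodule k W)) hex
    refine ⟨A ⊓ H, lt_of_le_of_ne inf_le_right fun h => hAH (inf_eq_right.1 h), fun B hB => ?_⟩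
    by_cases hBH : H ≤ B
    · exact Or.inl hBH
    right
    rcases hS.total hB hAS with h | h
    · exact inf_le_inf_right _ h
    have hfd : FiniteDimensional k (B ⊓ H : Submodule k W) :=
      Submodule.finiteDimensional_of_le inf_le_right
    have h1 : Module.finrank k (A ⊓ H : Submodule k W) ≤
        Module.finrank k (B ⊓ H : Submodule k W) :=
      Submodule.finrank_mono (inf_le_inf_right _ h)
    have h2 : Module.finrank k (B ⊓ H : Submodule k W) ≤ Module.finrank k H :=
      Submodule.finrank_mono inf_le_right
    have h3 := hmin (j := B) ⟨hB, hBH⟩ (by dsimp only; omega)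
    exact (Submodule.eq_of_le_of_finrank_le (inf_le_inf_right _ h) (by dsimp only at h3; omega)).ge
  · push Not at hex
    exact ⟨⊥, bot_lt_iff_ne_bot.2 hH, fun A hA => Or.inl (hex A hA)⟩

/-- Two flags on a finite-dimensional space admit a common adapted basis. -/
theorem exists_linearIndependent_adapted {S T : Set (Submodule k W)} (hS : IsChain (· ≤ ·) S)
    (hT : IsChain (· ≤ ·) T) (H : Submodule k W) [FiniteDimensional k H] :
    ∃ (n : ℕ) (e : Fin n → W), LinearIndependent k e ∧ Submodule.span k (range e) = H ∧
      ∀ A ∈ S ∪ T, A ⊓ H ≤ Submodule.span k (e '' {i | e i ∈ A}) := by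
  induction hd : Module.finrank k H using Nat.strong_induction_on generalizing H with
  | _ d ih =>
  by_cases hH : H = ⊥
  · refine ⟨0, Fin.elim0, linearIndependent_empty_type, by simp [hH], fun A _ => by simp [hH]⟩
  obtain ⟨ψ, ⟨x, hxH, hx⟩, hSψ⟩ := exists_hyperplane_of_isChain hS H hH
  have hlt : H ⊓ LinearMap.ker ψ < H :=
    lt_of_le_of_ne inf_le_left fun h => hx (LinearMap.mem_ker.1 (inf_eq_left.1 h hxH))
  have hfd : FiniteDimensional k (H ⊓ LinearMap.ker ψ : Submodule k W) :=
    Submodule.finiteDimensional_of_le inf_le_left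
  obtain ⟨n, e, hli, hspan, he⟩ :=
    ih _ (hd ▸ Submodule.finrank_lt_finrank_of_lt hlt) (H ⊓ LinearMap.ker ψ) rfl
  -- The new basis vector is taken from the smallest trace of `T` that leaves the hyperplane, so it
  -- lies in every other member whose trace does.
  obtain ⟨v, hvH, hv, hTv⟩ : ∃ v ∈ H, ψ v ≠ 0 ∧ ∀ A ∈ T, A ⊓ H ≤ LinearMap.ker ψ ∨ v ∈ A := by
    by_cases hex : ∃ A, A ∈ T ∧ ¬ A ⊓ H ≤ LinearMap.ker ψ
    · obtain ⟨A, ⟨hAT, hA⟩, hmin⟩ := exists_minimalFor_of_wellFoundedLT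
        (fun A => A ∈ T ∧ ¬ A ⊓ H ≤ LinearMap.ker ψ)
        (fun A => Module.finrank k (A ⊓ H : Submodule k W)) hex
      obtain ⟨v, hvA, hv⟩ := SetLike.not_le_iff_exists.1 hA
      refine ⟨v, hvA.2, hv, fun B hB => or_iff_not_imp_left.2 fun hBψ => ?_⟩
      rcases hT.total hAT hB with h | h
      · exact h hvA.1
      have hfd' : FiniteDimensional k (A ⊓ H : Submodule k W) :=
        Submodule.finiteDimensional_of_le inf_le_right
      have h1 : Module.finrank k (B ⊓ H : Submodule k W) ≤
          Module.finrank k (A ⊓ H : Submodule k W) :=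
        Submodule.finrank_mono (inf_le_inf_right _ h)
      have h2 := Submodule.eq_of_le_of_finrank_le (inf_le_inf_right H h)
        (hmin (j := B) ⟨hB, hBψ⟩ h1)
      exact (h2.ge hvA).1
    · push Not at hex
      exact ⟨x, hxH, hx, fun A hA => Or.inl (hex A hA)⟩
  have hdecomp : ∀ y ∈ H, y - (ψ y / ψ v) • v ∈ H ⊓ LinearMap.ker ψ := fun y hy =>
    ⟨H.sub_mem hy (H.smul_mem _ hvH), by simp [hv]⟩
  refine ⟨n + 1, Fin.cons v e, linearIndependent_finCons.2 ⟨hli, fun h => ?_⟩, ?_, fun A hA => ?_⟩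
  · rw [hspan] at h
    exact hv h.2
  · rw [Fin.range_cons, Submodule.span_insert, hspan]
    refine le_antisymm (sup_le (Submodule.span_le.2 (by simpa using hvH)) inf_le_left) fun y hy => ?_
    exact Submodule.mem_sup.2 ⟨_, Submodule.mem_span_singleton.2 ⟨ψ y / ψ v, rfl⟩, _,
      hdecomp y hy, by abel⟩
  · have hmono : Submodule.span k (e '' {i | e i ∈ A}) ≤
        Submodule.span k ((Fin.cons v e : Fin (n + 1) → W) ''
          {i | (Fin.cons v e : Fin (n + 1) → W) i ∈ A}) := by
      refine Submodule.span_mono ?_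
      rintro _ ⟨i, hi, rfl⟩
      exact ⟨i.succ, by simpa using hi, by simp⟩
    -- Either the trace of `A` lies in the hyperplane, where the induction applies, or subtracting a
    -- multiple of `v` moves vectors there without leaving `A`.
    have hor : A ⊓ H ≤ LinearMap.ker ψ ∨ v ∈ A := by
      rcases hA with hA | hA
      · exact (hSψ A hA).symm.imp_right fun h => h hvH
      · exact hTv A hA
    rcases hor with h | h
    · exact fun y hy => hmono (he A hA ⟨hy.1, hy.2, h hy⟩)
    · intro y hy
      rw [← sub_add_cancel y ((ψ y / ψ v) • v)]
      refine Submodule.add_mem _ (hmono (he A hA ⟨A.sub_mem hy.1 (A.smul_mem _ h),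
        hdecomp y hy.2⟩)) (Submodule.smul_mem _ _
          (Submodule.subset_span ⟨0, by simpa using h, by simp⟩))

end Flags

/-! ### Uniqueness of persistence diagrams -/

section Uniqueness

/-- A finite multiset in a partial order is determined by the numbers of its elements below each
of the elements. -/
theorem multiset_eq_of_countP_le_eq {α : Type*} [PartialOrder α] [DecidableLE α] (X Y : Multiset α)
    (h : ∀ a, a ∈ X ∨ a ∈ Y → X.countP (· ≤ a) = Y.countP (· ≤ a)) : X = Y := by
  classical
  induction hn : X.card using Nat.strong_induction_on generalizing X Y with
  | _ n ih =>
  by_cases hne : ∃ a, a ∈ (X + Y).toFinset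
  · obtain ⟨a, ha⟩ := Finset.exists_minimal (s := (X + Y).toFinset) hne
    have hmem : ∀ b, b ∈ X ∨ b ∈ Y → b ≤ a → b = a := fun b hb hba =>
      le_antisymm hba (ha.2 (by simpa using hb) hba)
    have haXY : a ∈ X ∨ a ∈ Y := by simpa using ha.1
    have hX : 0 < X.countP (· ≤ a) ↔ a ∈ X := by
      rw [Multiset.countP_pos]
      exact ⟨fun ⟨b, hb, hba⟩ => hmem b (Or.inl hb) hba ▸ hb, fun h => ⟨a, h, le_rfl⟩⟩
    have hY : 0 < Y.countP (· ≤ a) ↔ a ∈ Y := by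
      rw [Multiset.countP_pos]
      exact ⟨fun ⟨b, hb, hba⟩ => hmem b (Or.inr hb) hba ▸ hb, fun h => ⟨a, h, le_rfl⟩⟩
    have hiff : a ∈ X ↔ a ∈ Y := by rw [← hX, ← hY, h a haXY]
    have haX : a ∈ X := haXY.elim id hiff.2
    obtain ⟨X', rfl⟩ := Multiset.exists_cons_of_mem haX
    obtain ⟨Y', rfl⟩ := Multiset.exists_cons_of_mem (hiff.1 haX)
    congr 1
    refine ih X'.card (by rw [← hn]; simp) X' Y' (fun b hb => ?_) rfl
    have := h b (hb.imp (Multiset.mem_cons_of_mem) (Multiset.mem_cons_of_mem))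
    simpa [Multiset.countP_cons] using this
  · push Not at hne
    have : X + Y = 0 := Multiset.eq_zero_of_forall_notMem fun a ha => hne a (by simpa using ha)
    rw [add_eq_zero] at this
    rw [this.1, this.2]

/-- The interval with endpoints `y` contains the interval with endpoints `x`. -/
def Dominates (y x : ℝ × WithTop ℝ) : Prop := y.1 ≤ x.1 ∧ x.2 ≤ y.2

/-- Points that do not lie on the diagonal. -/
def OffDiagonal (x : ℝ × WithTop ℝ) : Prop := x.2 ≠ (x.1 : WithTop ℝ)

open Classical in
theorem multiset_eq_of_countP_dominates_eq (X Y : Multiset (ℝ × WithTop ℝ))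
    (h : ∀ a, a ∈ X ∨ a ∈ Y → X.countP (Dominates · a) = Y.countP (Dominates · a)) : X = Y :=
  letI : PartialOrder (ℝ × WithTop ℝ) :=
    { le := Dominates
      lt := fun a b => Dominates a b ∧ ¬ Dominates b a
      lt_iff_le_not_ge := fun _ _ => Iff.rfl
      le_refl := fun _ => ⟨le_rfl, le_rfl⟩
      le_trans := fun _ _ _ h h' => ⟨h.1.trans h'.1, h'.2.trans h.2⟩
      le_antisymm := fun _ _ h h' => Prod.ext (h.1.antisymm h'.1) (h'.2.antisymm h.2) }
  letI : DecidableLE (ℝ × WithTop ℝ) := fun _ _ => Classical.propDecidable _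
  multiset_eq_of_countP_le_eq X Y h

/-- The points strictly between the two coordinates of `x`. -/
def openGap (x : ℝ × WithTop ℝ) : Set ℝ := {t | x.1 < t ∧ (t : WithTop ℝ) < x.2}

/-- Passing to the open gap makes it irrelevant which endpoints `J` contains. The gap must be
nonempty, or every interval would contain it. -/
theorem endpoints_le_iff (J : RealInterval) (hJ : BddBelow J.carrier) {x : ℝ × WithTop ℝ}
    (hx : (x.1 : WithTop ℝ) < x.2) :
    Dominates J.endpoints x ↔ openGap x ⊆ J.carrier := by
  obtain ⟨b, d⟩ := x
  dsimp only at hx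
  constructor
  · rintro ⟨h1, h2⟩ t ⟨ht1, ht2⟩
    dsimp only at h1 h2 ht1 ht2
    obtain ⟨y, hy, hyt⟩ := exists_lt_of_csInf_lt J.nonempty (lt_of_le_of_lt h1 ht1)
    have : ∃ z ∈ J.carrier, t < z := by
      by_cases hb : BddAbove J.carrier
      · have h3 := ht2.trans_le h2
        simp only [RealInterval.endpoints, hb, if_true, WithTop.coe_lt_coe] at h3
        exact exists_lt_of_lt_csSup J.nonempty h3
      · exact not_bddAbove_iff.1 hb t
    obtain ⟨z, hz, htz⟩ := this
    exact J.ordConnected.out hy hz ⟨hyt.le, htz.le⟩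
  · intro h
    obtain ⟨u, hu1, hu2⟩ : ∃ u, b < u ∧ (u : WithTop ℝ) < d := by
      cases d with
      | top => exact ⟨b + 1, by linarith, WithTop.coe_lt_top _⟩
      | coe d =>
        obtain ⟨u, h1, h2⟩ := exists_between (WithTop.coe_lt_coe.1 hx)
        exact ⟨u, h1, WithTop.coe_lt_coe.2 h2⟩
    constructor
    · refine le_of_forall_gt_imp_ge_of_dense fun t ht => ?_
      -- `t` may lie beyond the right end; the minimum with `u` brings it back into the gap.
      have hmem : min t u ∈ J.carrier := h ⟨lt_min ht hu1,
        lt_of_le_of_lt (WithTop.coe_le_coe.2 (min_le_right t u)) hu2⟩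
      exact (csInf_le hJ hmem).trans (min_le_left t u)
    · by_cases hb : BddAbove J.carrier
      · simp only [RealInterval.endpoints, hb, if_true]
        by_contra! hlt
        set s := sSup J.carrier
        obtain ⟨t, ht1, ht2⟩ : ∃ t, s < t ∧ (t : WithTop ℝ) < d := by
          cases d with
          | top => exact ⟨s + 1, by linarith, WithTop.coe_lt_top _⟩
          | coe d =>
            obtain ⟨u, h1, h2⟩ := exists_between (WithTop.coe_lt_coe.1 hlt)
            exact ⟨u, h1, WithTop.coe_lt_coe.2 h2⟩
        have hmem : max t u ∈ J.carrier := h ⟨lt_max_of_lt_right hu1, by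
          rcases max_choice t u with h | h <;> rw [h] <;> assumption⟩
        exact absurd (le_csSup hb hmem) (not_le.2 (ht1.trans_le (le_max_left t u)))
      · simp [RealInterval.endpoints, hb]

theorem openGap_nonempty {x : ℝ × WithTop ℝ} (hx : (x.1 : WithTop ℝ) < x.2) :
    (openGap x).Nonempty := by
  obtain ⟨b, d⟩ := x
  cases d with
  | top => exact ⟨b + 1, by simp [openGap]⟩
  | coe d =>
    obtain ⟨u, h1, h2⟩ := exists_between (WithTop.coe_lt_coe.1 hx)
    exact ⟨u, h1, WithTop.coe_lt_coe.2 h2⟩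

theorem endpoints_fst_le_snd (J : RealInterval) (hJ : BddBelow J.carrier) :
    (J.endpoints.1 : WithTop ℝ) ≤ J.endpoints.2 := by
  by_cases hb : BddAbove J.carrier
  · simpa [RealInterval.endpoints, hb] using csInf_le_csSup J.nonempty hJ hb
  · simp [RealInterval.endpoints, hb]

open Classical in
/-- The rank of a structure map of a direct sum of interval modules is the number of the intervals
that contain both parameters. -/
theorem finrank_range_directSum {k : Type u} [Field k] {n : ℕ} (J : Fin n → RealInterval)
    {s t : ℝ} (h : s ≤ t) :
    Module.finrank k (LinearMap.range
      ((directSum fun i => intervalModule.{u, w} k (J i)).map (homOfLE h)).hom) =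
    (Finset.univ.filter fun i => s ∈ (J i).carrier ∧ t ∈ (J i).carrier).card := by
  let f : (∀ i, intervalSpace.{u, w} k (J i) s) →ₗ[k] (∀ i, intervalSpace.{u, w} k (J i) t) :=
    LinearMap.pi fun i => intervalMap.{u, w} k (J i) s t ∘ₗ LinearMap.proj i
  change Module.finrank k (LinearMap.range f) = _
  have hfx : ∀ x i, ((f x i : intervalSpace.{u, w} k (J i) t) : ULift.{w} k) =
      if t ∈ (J i).carrier then (x i : ULift.{w} k) else 0 := by
    intro x i
    change ((intervalMap.{u, w} k (J i) s t (x i) : intervalSpace.{u, w} k (J i) t) :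
      ULift.{w} k) = _
    by_cases ht : t ∈ (J i).carrier <;> simp [intervalMap, ht]
  let I := {i // s ∈ (J i).carrier ∧ t ∈ (J i).carrier}
  let π : (∀ i, intervalSpace.{u, w} k (J i) t) →ₗ[k] (I → ULift.{w} k) :=
    LinearMap.pi fun i => (intervalSpace.{u, w} k (J i) t).subtype ∘ₗ LinearMap.proj i.1
  -- The image is supported exactly on the coordinates in `I`, where it is unrestricted.
  have hbij : Function.Bijective (π.domRestrict (LinearMap.range f)) := by
    constructor
    · rw [injective_iff_map_eq_zero]
      rintro ⟨_, x, rfl⟩ hx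
      refine Subtype.ext (funext fun i => Subtype.ext ?_)
      change ((f x i : intervalSpace.{u, w} k (J i) t) : ULift.{w} k) = 0
      by_cases hs : s ∈ (J i).carrier
      · by_cases ht : t ∈ (J i).carrier
        · exact congrFun hx ⟨i, hs, ht⟩
        · rw [hfx, if_neg ht]
      · have h0 := (x i).2
        simp only [intervalSpace, hs, if_false, Submodule.mem_bot] at h0
        simp [hfx, h0]
    · intro y
      refine ⟨⟨f fun i => if hi : s ∈ (J i).carrier ∧ t ∈ (J i).carrier then
        ⟨y ⟨i, hi⟩, by simp [intervalSpace, hi.1]⟩ else 0, _, rfl⟩, ?_⟩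
      funext i
      refine (hfx _ _).trans ?_
      rw [if_pos i.2.2, dif_pos i.2]
  rw [(LinearEquiv.ofBijective _ hbij).finrank_eq,
    (LinearEquiv.piCongrRight fun _ : I => (ULift.moduleEquiv : ULift.{w} k ≃ₗ[k] k)).finrank_eq,
    Module.finrank_fintype_fun_eq_card, Fintype.card_subtype]

theorem finrank_range_map_eq {k : Type u} [Field k] {A B : PersistenceModule.{u, w} k}
    (α : A ≅ B) {s t : ℝ} (f : s ⟶ t) :
    Module.finrank k (LinearMap.range (A.map f).hom) =
      Module.finrank k (LinearMap.range (B.map f).hom) := by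
  have hnat : (α.app t).toLinearEquiv.toLinearMap ∘ₗ (A.map f).hom =
      (B.map f).hom ∘ₗ (α.app s).toLinearEquiv.toLinearMap := by
    exact congrArg ModuleCat.Hom.hom (α.hom.naturality f)
  have h1 : (LinearMap.range (A.map f).hom).map (α.app t).toLinearEquiv.toLinearMap =
      LinearMap.range (B.map f).hom := by
    rw [← LinearMap.range_comp, hnat, LinearMap.range_comp, LinearEquiv.range, Submodule.map_top]
  rw [← h1]
  exact ((α.app t).toLinearEquiv.submoduleMap _).finrank_eq

open Classical in
/-- The number of the intervals of a family that contain a gap is bounded by the number of those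
that contain both of any two points of the gap, and this bound is attained. -/
theorem exists_card_filter_eq {n : ℕ} (J : Fin n → RealInterval) {x : ℝ × WithTop ℝ}
    (hx : (x.1 : WithTop ℝ) < x.2) :
    ∃ s ∈ openGap x, ∃ t ∈ openGap x, s ≤ t ∧
      (Finset.univ.filter fun i => s ∈ (J i).carrier ∧ t ∈ (J i).carrier).card =
      (Finset.univ.filter fun i => openGap x ⊆ (J i).carrier).card := by
  obtain ⟨u, hu⟩ := openGap_nonempty hx
  -- Each interval not containing the gap misses a point `y i` of it; an interval containing the
  -- extreme chosen points contains all of them. The extra `u` covers an empty family.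
  have hc : ∀ i, ∃ y ∈ openGap x, y ∈ (J i).carrier → openGap x ⊆ (J i).carrier := by
    intro i
    by_cases h : openGap x ⊆ (J i).carrier
    · exact ⟨u, hu, fun _ => h⟩
    · obtain ⟨y, hy, hyJ⟩ := not_subset.1 h
      exact ⟨y, hy, fun h => absurd h hyJ⟩
  choose y hy hyJ using hc
  let Y : Finset ℝ := insert u (Finset.univ.image y)
  have hY : Y.Nonempty := Finset.insert_nonempty _ _
  have hYgap : ∀ z ∈ Y, z ∈ openGap x := by
    intro z hz
    simp only [Y, Finset.mem_insert, Finset.mem_image, Finset.mem_univ, true_and] at hz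
    rcases hz with rfl | ⟨i, rfl⟩
    exacts [hu, hy i]
  refine ⟨Y.min' hY, hYgap _ (Y.min'_mem hY), Y.max' hY, hYgap _ (Y.max'_mem hY),
    Y.min'_le_max' hY, ?_⟩
  congr 1
  ext i
  simp only [Finset.mem_filter, Finset.mem_univ, true_and]
  refine ⟨fun h => hyJ i ((J i).ordConnected.out h.1 h.2 ⟨Y.min'_le _ ?_, Y.le_max' _ ?_⟩),
    fun h => ⟨h (hYgap _ (Y.min'_mem hY)), h (hYgap _ (Y.max'_mem hY))⟩⟩ <;>
  exact Finset.mem_insert_of_mem (Finset.mem_image_of_mem y (Finset.mem_univ i))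

-- Choose `s`, `t` so that the rank is the exact count for `J'`; for `J` the same rank is only an
-- upper bound.
open Classical in
theorem card_openGap_subset_le {k : Type u} [Field k] {n n' : ℕ} {J : Fin n → RealInterval}
    {J' : Fin n' → RealInterval}
    (α : (directSum fun i => intervalModule.{u, w} k (J i)) ≅
      directSum fun i => intervalModule.{u, w} k (J' i))
    {x : ℝ × WithTop ℝ} (hx : (x.1 : WithTop ℝ) < x.2) :
    (Finset.univ.filter fun i => openGap x ⊆ (J i).carrier).card ≤
      (Finset.univ.filter fun i => openGap x ⊆ (J' i).carrier).card := by
  obtain ⟨s, hs, t, ht, hst, hcard⟩ := exists_card_filter_eq J' hx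
  rw [← hcard, ← finrank_range_directSum.{u, w} (k := k) J' hst, ← finrank_range_map_eq α,
    finrank_range_directSum]
  refine Finset.card_le_card fun i hi => ?_
  simp only [Finset.mem_filter, Finset.mem_univ, true_and] at hi ⊢
  exact ⟨hi hs, hi ht⟩

-- Diagonal points have infinite multiplicity in either diagram, whatever the finite multisets are.
open Classical in
theorem ofMultiset_eq_of_filter_eq {X Y : Multiset (ℝ × WithTop ℝ)}
    (h : X.filter OffDiagonal = Y.filter OffDiagonal) :
    Bar.ofMultiset X = Bar.ofMultiset Y := by
  refine Subtype.ext (funext fun x => ?_)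
  change withDiagonal X x = withDiagonal Y x
  by_cases hx : x.2 = x.1
  · simp [withDiagonal, hx]
  · have := congrArg (Multiset.count x) h
    rw [Multiset.count_filter_of_pos (p := OffDiagonal) hx,
      Multiset.count_filter_of_pos (p := OffDiagonal) hx] at this
    simp [withDiagonal, this]

/-- The persistence diagram of a persistence module is unique. -/
theorem IsDiagramOf.unique {k : Type u} [Field k] {A : PersistenceModule.{u, max u w} k}
    {D D' : Bar} (h : IsDiagramOf.{u, w} A D) (h' : IsDiagramOf.{u, w} A D') : D = D' := by
  classical
  obtain ⟨n, J, hJ, ⟨α⟩, rfl⟩ := h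
  obtain ⟨n', J', hJ', ⟨α'⟩, rfl⟩ := h'
  apply ofMultiset_eq_of_filter_eq
  have key : ∀ {n : ℕ} (J : Fin n → RealInterval), (∀ i, BddBelow (J i).carrier) →
      ∀ x : ℝ × WithTop ℝ, (x.1 : WithTop ℝ) < x.2 →
      Multiset.countP (Dominates · x)
        ((Finset.univ.val.map fun i => (J i).endpoints).filter OffDiagonal) =
      (Finset.univ.filter fun i => openGap x ⊆ (J i).carrier).card := by
    intro n J hJ x hx
    rw [Multiset.countP_filter, Multiset.countP_map, Finset.card_def, Finset.filter_val]
    congr 1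
    refine Multiset.filter_congr fun i _ => ?_
    rw [← endpoints_le_iff (J i) (hJ i) hx]
    -- Filtering loses nothing: a pair dominating a point above the diagonal is itself above it.
    refine ⟨fun h => h.1, fun h => ⟨h, ?_⟩⟩
    have h1 : ((J i).endpoints.1 : WithTop ℝ) ≤ x.1 := WithTop.coe_le_coe.2 h.1
    exact (lt_of_le_of_lt h1 (lt_of_lt_of_le hx h.2)).ne'
  refine multiset_eq_of_countP_dominates_eq _ _ fun x hx => ?_
  have hlt : (x.1 : WithTop ℝ) < x.2 := by
    have aux : ∀ {n : ℕ} (J : Fin n → RealInterval), (∀ i, BddBelow (J i).carrier) →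
        x ∈ (Finset.univ.val.map fun i => (J i).endpoints).filter OffDiagonal →
        (x.1 : WithTop ℝ) < x.2 := by
      intro n J hJ hx
      obtain ⟨hx1, hx2⟩ := Multiset.mem_filter.1 hx
      obtain ⟨i, -, rfl⟩ := Multiset.mem_map.1 hx1
      exact lt_of_le_of_ne (endpoints_fst_le_snd _ (hJ i)) (Ne.symm hx2)
    exact hx.elim (aux J hJ) (aux J' hJ')
  refine (key J hJ x hlt).trans (Eq.trans ?_ (key J' hJ' x hlt).symm)
  exact le_antisymm (card_openGap_subset_le (α.symm ≪≫ α') hlt)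
    (card_openGap_subset_le (α'.symm ≪≫ α) hlt)

end Uniqueness

/-! ### Interval decompositions of persistent homology -/

section Decomposition

/-- A finite linearly independent family has a dual family of coordinate functionals. -/
theorem exists_coordinates {k W ι : Type*} [Field k] [AddCommGroup W] [Module k W]
    {e : ι → W} (he : LinearIndependent k e) :
    ∃ φ : W →ₗ[k] ι →₀ k, ∀ i, φ (e i) = Finsupp.single i 1 := by
  obtain ⟨φ, hφ⟩ := LinearMap.exists_extend he.repr
  refine ⟨φ, fun i => ?_⟩
  rw [← he.repr_eq_single i ⟨e i, Submodule.subset_span ⟨i, rfl⟩⟩ rfl, ← hφ]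
  rfl

variable {k W ι : Type*} [Field k] [AddCommGroup W] [Module k W] {e : ι → W}
  {φ : W →ₗ[k] ι →₀ k}

theorem coordinates_eq_zero (hφ : ∀ i, φ (e i) = Finsupp.single i 1) {A : Submodule k W}
    (hA : A ≤ Submodule.span k (e '' {i | e i ∈ A})) {z : W} (hz : z ∈ A) {i : ι} (hi : e i ∉ A) :
    φ z i = 0 := by
  have : A ≤ LinearMap.ker (Finsupp.lapply i ∘ₗ φ) := by
    refine hA.trans (Submodule.span_le.2 ?_)
    rintro _ ⟨j, hj, rfl⟩
    have hne : j ≠ i := fun h => hi (h ▸ hj)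
    simp [hφ, hne]
  exact this hz

theorem sum_coordinates (hφ : ∀ i, φ (e i) = Finsupp.single i 1) {A : Submodule k W}
    (hA : A ≤ Submodule.span k (e '' {i | e i ∈ A})) {z : W} (hz : z ∈ A) :
    Finsupp.linearCombination k e (φ z) = z := by
  have : A ≤ LinearMap.eqLocus (Finsupp.linearCombination k e ∘ₗ φ) LinearMap.id := by
    refine hA.trans (Submodule.span_le.2 ?_)
    rintro _ ⟨j, -, rfl⟩
    simp [hφ]
  exact this hz

end Decomposition

section Decomposition

variable {k : Type u} [Field k] {V : Type v} [LinearOrder V] {K : PreAbstractSimplicialComplex V}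

/-- If a linearly independent family of chains is adapted to the cycles and to the boundaries of
all sublevel complexes of `f`, then the persistent homology of `f` is the direct sum of the
interval modules of the nonempty sets of parameters at which a member of the family is a cycle, but
not a boundary. -/
theorem nonempty_persistentHomology_iso (f : K.faces → ℝ) (hf : IsFilterFunction f) (p : ℕ)
    {ι : Type*} {e : ι → (Fin (p + 1) → V) →₀ k} (he : LinearIndependent k e)
    (hZ : ∀ t, cycles k (sublevel f hf t) p ≤
      Submodule.span k (e '' {i | e i ∈ cycles k (sublevel f hf t) p}))
    (hB : ∀ t, boundaries k (sublevel f hf t) p ≤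
      Submodule.span k (e '' {i | e i ∈ boundaries k (sublevel f hf t) p}))
    {n : ℕ} (J : Fin n → RealInterval) (c : Fin n → ι) (hc : Function.Injective c)
    (hJ : ∀ a t, t ∈ (J a).carrier ↔
      e (c a) ∈ cycles k (sublevel f hf t) p ∧ e (c a) ∉ boundaries k (sublevel f hf t) p)
    (hcJ : ∀ i t, e i ∈ cycles k (sublevel f hf t) p →
      e i ∉ boundaries k (sublevel f hf t) p → i ∈ range c) :
    Nonempty (persistentHomology k f hf p ≅
      directSum fun a => intervalModule.{u, v} k (J a)) := by
  classical
  obtain ⟨φ, hφ⟩ := exists_coordinates he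
  -- Reads the coordinates of a cycle along the basis vectors alive at `t`; it is onto, with the
  -- boundaries as kernel.
  let ψ : ∀ t, cycles k (sublevel f hf t) p →ₗ[k] ∀ a, intervalSpace.{u, v} k (J a) t := fun t =>
    LinearMap.pi fun a => LinearMap.codRestrict _
      ((if t ∈ (J a).carrier then LinearMap.id else 0) ∘ₗ
        (ULift.moduleEquiv : ULift.{v} k ≃ₗ[k] k).symm.toLinearMap ∘ₗ
        Finsupp.lapply (c a) ∘ₗ φ ∘ₗ Submodule.subtype _) (by
          intro z
          by_cases ht : t ∈ (J a).carrier <;> simp [intervalSpace, ht])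
  have hψ : ∀ t z a, ((ψ t z a : intervalSpace.{u, v} k (J a) t) : ULift.{v} k) =
      if t ∈ (J a).carrier then ULift.up (φ z.1 (c a)) else 0 := by
    intro t z a
    by_cases ht : t ∈ (J a).carrier <;> simp [ψ, ht]
  have hker : ∀ t, (boundaries k (sublevel f hf t) p).comap
      (cycles k (sublevel f hf t) p).subtype = LinearMap.ker (ψ t) := by
    intro t
    ext z
    rw [Submodule.mem_comap, LinearMap.mem_ker]
    constructor
    · intro hz
      refine funext fun a => Subtype.ext ((hψ t z a).trans ?_)
      split_ifs with ht
      · have := coordinates_eq_zero hφ (hB t) hz ((hJ a t).1 ht).2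
        simp only [Submodule.subtype_apply] at this
        rw [this]
        rfl
      · rfl
    · intro hz
      change z.1 ∈ _
      rw [← sum_coordinates hφ (hZ t) z.2, Finsupp.linearCombination_apply]
      refine Submodule.sum_mem _ fun i hi => Submodule.smul_mem _ _ ?_
      by_contra hiB
      have hiZ : e i ∈ cycles k (sublevel f hf t) p := by
        by_contra h
        exact Finsupp.mem_support_iff.1 hi (coordinates_eq_zero hφ (hZ t) z.2 h)
      obtain ⟨a, rfl⟩ := hcJ i t hiZ hiB
      have h1 := hψ t z a
      rw [hz, if_pos ((hJ a t).2 ⟨hiZ, hiB⟩)] at h1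
      exact Finsupp.mem_support_iff.1 hi (congrArg ULift.down h1).symm
  have hsurj : ∀ t, Function.Surjective (ψ t) := by
    intro t y
    let z : (Fin (p + 1) → V) →₀ k := ∑ a, (y a : ULift.{v} k).down • e (c a)
    have hz : z ∈ cycles k (sublevel f hf t) p := by
      refine Submodule.sum_mem _ fun a _ => ?_
      by_cases ht : t ∈ (J a).carrier
      · exact Submodule.smul_mem _ _ ((hJ a t).1 ht).1
      · have h0 := (y a).2
        simp only [intervalSpace, ht, if_false, Submodule.mem_bot] at h0
        rw [h0]
        simp
    refine ⟨⟨z, hz⟩, funext fun a => Subtype.ext ((hψ t _ a).trans ?_)⟩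
    split_ifs with ht
    · have : φ z (c a) = (y a : ULift.{v} k).down := by
        simp [z, hφ, Finsupp.single_apply, hc.eq_iff]
      simp only [this]
    · have h0 := (y a).2
      simp only [intervalSpace, ht, if_false, Submodule.mem_bot] at h0
      exact h0.symm
  let α : ∀ t, homology k (sublevel f hf t) p ≃ₗ[k] ∀ a, intervalSpace.{u, v} k (J a) t := fun t =>
    (Submodule.quotEquivOfEq _ _ (hker t)).trans ((ψ t).quotKerEquivOfSurjective (hsurj t))
  refine ⟨NatIso.ofComponents (fun t => (α t).toModuleIso) fun {s t} g => ?_⟩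
  ext x
  obtain ⟨z, rfl⟩ := Submodule.Quotient.mk_surjective _ x
  refine funext fun a => Subtype.ext ?_
  change ((ψ t (Submodule.inclusion (cycles_mono k (sublevel_mono f hf (leOfHom g)) p) z) a :
    intervalSpace.{u, v} k (J a) t) : ULift.{v} k) =
    ((intervalMap.{u, v} k (J a) s t (ψ s z a) : intervalSpace.{u, v} k (J a) t) : ULift.{v} k)
  have hmap : ∀ y, ((intervalMap.{u, v} k (J a) s t y : intervalSpace.{u, v} k (J a) t) :
      ULift.{v} k) = if t ∈ (J a).carrier then (y : ULift.{v} k) else 0 := by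
    intro y
    by_cases ht : t ∈ (J a).carrier <;> simp [intervalMap, ht]
  rw [hmap, hψ, hψ]
  split_ifs with ht hs
  · rfl
  · have hs' : e (c a) ∉ cycles k (sublevel f hf s) p := fun h => hs ((hJ a s).2 ⟨h, fun h' =>
      ((hJ a t).1 ht).2 (boundaries_mono k (sublevel_mono f hf (leOfHom g)) p h')⟩)
    have := coordinates_eq_zero hφ (hZ s) z.2 hs'
    simp only [Submodule.coe_inclusion, this]
    rfl
  · rfl

end Decomposition

/-! ### Ordering equivalent filter functions -/

section Ordering

variable {V : Type v} {K : PreAbstractSimplicialComplex V}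

theorem OrderingEquivalent.lt_iff {f g : K.faces → ℝ} (h : OrderingEquivalent f g)
    (σ τ : K.faces) : f σ < f τ ↔ g σ < g τ := by
  rw [← not_le, ← not_le, h]

theorem sublevel_apply_eq {f g : K.faces → ℝ} (h : OrderingEquivalent g f)
    (hf : IsFilterFunction f) (hg : IsFilterFunction g) (ρ : K.faces) :
    sublevel g hg (g ρ) = sublevel f hf (f ρ) := by
  refine PreAbstractSimplicialComplex.ext (Set.ext fun σ => ?_)
  exact exists_congr fun hσ => h ⟨σ, hσ⟩ ρ

/-- Round `t` down to the largest value of `g` not exceeding it. This reduces real parameters to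
simplices, the only data that equivalent functions share. -/
theorem exists_sublevel_eq_apply [Finite K.faces] (g : K.faces → ℝ) (hg : IsFilterFunction g)
    (t : ℝ) : (sublevel g hg t).faces = ∅ ∨
      ∃ ρ, g ρ ≤ t ∧ sublevel g hg t = sublevel g hg (g ρ) := by
  by_cases h : ∃ ρ, g ρ ≤ t
  · right
    obtain ⟨ρ, hρ, hmax⟩ := Set.exists_max_image {ρ | g ρ ≤ t} g (Set.toFinite _) h
    refine ⟨ρ, hρ, PreAbstractSimplicialComplex.ext (Set.ext fun σ => ?_)⟩
    exact exists_congr fun hσ => ⟨fun h => hmax ⟨σ, hσ⟩ h, fun h => h.trans hρ⟩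
  · left
    push Not at h
    exact Set.eq_empty_of_forall_notMem fun σ ⟨hσ, hσt⟩ => not_lt.2 hσt (h ⟨σ, hσ⟩)

/-- The simplex at which a monotone property of subcomplexes appears in the filtration depends only
on the pre-order induced on the simplices. -/
theorem exists_critical_simplex [Finite K.faces] (f : K.faces → ℝ) (hf : IsFilterFunction f)
    {P : PreAbstractSimplicialComplex V → Prop} (hP : ∀ K L, K ≤ L → P K → P L)
    (hP0 : ∀ L, L.faces = ∅ → ¬ P L) :
    (∃ σ : K.faces, ∀ (g : K.faces → ℝ) (hg : IsFilterFunction g), OrderingEquivalent g f →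
      ∀ t, P (sublevel g hg t) ↔ g σ ≤ t) ∨
    (∀ (g : K.faces → ℝ) (hg : IsFilterFunction g), OrderingEquivalent g f →
      ∀ t, ¬ P (sublevel g hg t)) := by
  by_cases h : ∃ σ, P (sublevel f hf (f σ))
  · left
    obtain ⟨σ, hσ, hmin⟩ := Set.exists_min_image {σ | P (sublevel f hf (f σ))} f (Set.toFinite _) h
    refine ⟨σ, fun g hg hgf t => ⟨fun ht => ?_, fun ht => ?_⟩⟩
    · obtain h0 | ⟨ρ, hρ, hρt⟩ := exists_sublevel_eq_apply g hg t
      · exact absurd ht (hP0 _ h0)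
      · rw [hρt, sublevel_apply_eq hgf hf hg] at ht
        exact ((hgf σ ρ).2 (hmin ρ ht)).trans hρ
    · refine hP _ _ (sublevel_mono g hg ht) ?_
      rw [sublevel_apply_eq hgf hf hg]
      exact hσ
  · right
    push Not at h
    intro g hg hgf t ht
    obtain h0 | ⟨ρ, -, hρt⟩ := exists_sublevel_eq_apply g hg t
    · exact hP0 _ h0 ht
    · rw [hρt, sublevel_apply_eq hgf hf hg] at ht
      exact h ρ ht

end Ordering

/-! ### Persistence diagrams of ordering equivalent filter functions -/

section Diagrams

variable (k : Type u) [Field k] {V : Type v} [LinearOrder V] {K : PreAbstractSimplicialComplex V}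

theorem chains_eq_bot {L : PreAbstractSimplicialComplex V} (hL : L.faces = ∅) (p : ℕ) :
    chains k L p = ⊥ := by
  refine (Submodule.span_eq_bot).2 ?_
  rintro _ ⟨v, -, hv, -⟩
  simp [hL] at hv

theorem cycles_le_chains (L : PreAbstractSimplicialComplex V) (p : ℕ) :
    cycles k L p ≤ chains k L p := by
  cases p with
  | zero => exact le_rfl
  | succ p => exact inf_le_left

theorem finiteDimensional_chains [Finite K.faces] (p : ℕ) : FiniteDimensional k (chains k K p) := by
  refine FiniteDimensional.span_of_finite k ?_
  have hfin : {v : Fin (p + 1) → V | StrictMono v ∧ Finset.univ.image v ∈ K.faces}.Finite := by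
    refine Set.Finite.of_finite_image (f := fun v => Finset.univ.image v)
      ((Set.toFinite K.faces).subset ?_) ?_
    · rintro _ ⟨v, hv, rfl⟩
      exact hv.2
    · intro v hv v' hv' h
      -- An increasing tuple is determined by its set of vertices.
      refine (StrictMono.range_inj hv.1 hv'.1).1 ?_
      have := congrArg (fun s : Finset V => (s : Set V)) h
      simpa using this
  refine (hfin.image fun v => Finsupp.single v (1 : k)).subset ?_
  rintro _ ⟨v, hv, hvK, rfl⟩
  exact ⟨v, ⟨hv, hvK⟩, rfl⟩

/-- The chain `c` becomes a member of `Z` at the simplex `σ` in the filtrations by all filter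
functions that are ordering equivalent to `f`. -/
def AppearsAt {W : Type*} [AddCommMonoid W] [Module k W] (f : K.faces → ℝ)
    (Z : PreAbstractSimplicialComplex V → Submodule k W) (c : W) (σ : K.faces) : Prop :=
  ∀ (g : K.faces → ℝ) (hg : IsFilterFunction g), OrderingEquivalent g f →
    ∀ t, c ∈ Z (sublevel g hg t) ↔ g σ ≤ t

/-- The chain `c` is never a member of `Z` in the filtrations by filter functions that are ordering
equivalent to `f`. -/
def NeverAppears {W : Type*} [AddCommMonoid W] [Module k W] (f : K.faces → ℝ)
    (Z : PreAbstractSimplicialComplex V → Submodule k W) (c : W) : Prop :=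
  ∀ (g : K.faces → ℝ) (hg : IsFilterFunction g), OrderingEquivalent g f →
    ∀ t, c ∉ Z (sublevel g hg t)

/-- The persistence diagrams of all filter functions that are ordering equivalent to `f` are given
by the values of these functions at the same simplices. -/
theorem exists_simplices_isDgm [Finite K.faces] (f : K.faces → ℝ) (hf : IsFilterFunction f)
    (p : ℕ) :
    ∃ (m n : ℕ) (σ τ : Fin m → K.faces) (ρ : Fin n → K.faces),
      ∀ (g : K.faces → ℝ) (hg : IsFilterFunction g), OrderingEquivalent g f →
        IsDgm k g hg p (Bar.ofMultiset
          ((Finset.univ.val.map fun i => (g (σ i), ((g (τ i) : ℝ) : WithTop ℝ))) +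
            (Finset.univ.val.map fun j => (g (ρ j), (⊤ : WithTop ℝ))))) := by
  classical
  have hfd := finiteDimensional_chains k (K := K) p
  have hle : ∀ t, sublevel f hf t ≤ K := fun t σ hσ => hσ.1
  have hchain : ∀ Z : PreAbstractSimplicialComplex V → Submodule k ((Fin (p + 1) → V) →₀ k),
      Monotone Z → IsChain (· ≤ ·) (range fun t => Z (sublevel f hf t)) := fun Z hZ =>
    (hZ.comp fun _ _ h => sublevel_mono f hf h).isChain_range
  have hZmono : Monotone fun L : PreAbstractSimplicialComplex V => cycles k L p :=
    fun _ _ h => cycles_mono k h p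
  have hBmono : Monotone fun L : PreAbstractSimplicialComplex V => boundaries k L p :=
    fun _ _ h => boundaries_mono k h p
  obtain ⟨N, e, hli, -, he⟩ := exists_linearIndependent_adapted (hchain _ hZmono) (hchain _ hBmono)
    (chains k K p)
  -- the family is adapted to the filtrations by all equivalent filter functions
  have hadapted : ∀ Z : PreAbstractSimplicialComplex V → Submodule k ((Fin (p + 1) → V) →₀ k),
      (∀ L, Z L ≤ chains k L p) → (∀ t, Z (sublevel f hf t) ⊓ chains k K p ≤
        Submodule.span k (e '' {i | e i ∈ Z (sublevel f hf t)})) →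
      ∀ (g : K.faces → ℝ) (hg : IsFilterFunction g), OrderingEquivalent g f → ∀ t,
        Z (sublevel g hg t) ≤ Submodule.span k (e '' {i | e i ∈ Z (sublevel g hg t)}) := by
    intro Z hZ hZe g hg hgf t
    obtain h0 | ⟨ρ, -, hρ⟩ := exists_sublevel_eq_apply g hg t
    · exact (hZ _).trans (by rw [chains_eq_bot k h0]; exact bot_le)
    · rw [hρ, sublevel_apply_eq hgf hf hg]
      exact (le_inf le_rfl ((hZ _).trans (chains_mono k (hle _) p))).trans (hZe _)
  have hBchains : ∀ L : PreAbstractSimplicialComplex V, boundaries k L p ≤ chains k L p :=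
    fun L => (boundaries_le_cycles k L p).trans (cycles_le_chains k L p)
  have hZadapted := hadapted (fun L => cycles k L p) (fun L => cycles_le_chains k L p)
    fun t => he _ (Or.inl ⟨t, rfl⟩)
  have hBadapted := hadapted (fun L => boundaries k L p) hBchains
    fun t => he _ (Or.inr ⟨t, rfl⟩)
  have hcrit : ∀ Z : PreAbstractSimplicialComplex V → Submodule k ((Fin (p + 1) → V) →₀ k),
      Monotone Z → (∀ L, Z L ≤ chains k L p) → ∀ i,
      (∃ σ, AppearsAt k f Z (e i) σ) ∨ NeverAppears k f Z (e i) := by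
    intro Z hZ hZc i
    refine exists_critical_simplex f hf (P := fun L => e i ∈ Z L) (fun K L h hK => hZ h hK) ?_
    intro L hL hi
    have := hZc L hi
    rw [chains_eq_bot k hL] at this
    exact hli.ne_zero i this
  -- `I` indexes the finite bars and `I'` the infinite ones. The strict inequality drops vectors
  -- that become cycle and boundary simultaneously, whose bars would be empty.
  let I := {i // ∃ σ τ, AppearsAt k f (fun L => cycles k L p) (e i) σ ∧
    AppearsAt k f (fun L => boundaries k L p) (e i) τ ∧ f σ < f τ}
  let I' := {i // ∃ σ, AppearsAt k f (fun L => cycles k L p) (e i) σ ∧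
    NeverAppears k f (fun L => boundaries k L p) (e i)}
  let E := (Fintype.equivFin I).symm
  let E' := (Fintype.equivFin I').symm
  choose σ τ hσ hτ hστ using fun i : I => i.2
  choose ρ hρ hρ' using fun i : I' => i.2
  refine ⟨Fintype.card I, Fintype.card I', fun i => σ (E i), fun i => τ (E i), fun j => ρ (E' j),
    fun g hg hgf => ?_⟩
  have hgστ : ∀ i, g (σ i) < g (τ i) := fun i => (hgf.lt_iff _ _).2 (hστ i)
  let J : Fin (Fintype.card I) ⊕ Fin (Fintype.card I') → RealInterval := Sum.elim
    (fun i => ⟨Ico (g (σ (E i))) (g (τ (E i))), ⟨_, left_mem_Ico.2 (hgστ _)⟩, ordConnected_Ico⟩)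
    (fun j => ⟨Ici (g (ρ (E' j))), nonempty_Ici, ordConnected_Ici⟩)
  let c : Fin (Fintype.card I) ⊕ Fin (Fintype.card I') → Fin N :=
    Sum.elim (fun i => (E i).1) (fun j => (E' j).1)
  refine ⟨_, fun a => J (finSumFinEquiv.symm a), fun a => ?_, ?_, ?_⟩
  · change BddBelow (J (finSumFinEquiv.symm a)).carrier
    rcases finSumFinEquiv.symm a with i | j
    · exact bddBelow_Ico (a := g (σ (E i))) (b := g (τ (E i)))
    · exact bddBelow_Ici (a := g (ρ (E' j)))
  · refine nonempty_persistentHomology_iso g hg p hli (hZadapted g hg hgf) (hBadapted g hg hgf)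
      (fun a => J (finSumFinEquiv.symm a)) (fun a => c (finSumFinEquiv.symm a)) ?_ ?_ ?_
    · refine Function.Injective.comp ?_ finSumFinEquiv.symm.injective
      refine (Subtype.val_injective.comp E.injective).sumElim
        (Subtype.val_injective.comp E'.injective) fun i j hij => ?_
      have h1 := (hτ (E i) g hg hgf _).2 le_rfl
      have h2 := hρ' (E' j) g hg hgf (g (τ (E i)))
      have hij : (E i).1 = (E' j).1 := hij
      rw [hij] at h1
      exact h2 h1
    · intro a t
      rcases finSumFinEquiv.symm a with i | j
      · exact and_congr (hσ (E i) g hg hgf t).symm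
          (by rw [← not_le]; exact not_congr (hτ (E i) g hg hgf t).symm)
      · exact ⟨fun h => ⟨(hρ (E' j) g hg hgf t).2 h, hρ' (E' j) g hg hgf t⟩,
          fun h => (hρ (E' j) g hg hgf t).1 h.1⟩
    · intro i t hiZ hiB
      suffices h : i ∈ range c by
        obtain ⟨a, rfl⟩ := h
        exact ⟨finSumFinEquiv a, by simp⟩
      obtain ⟨s, hs⟩ | hs := hcrit _ hZmono (fun L => cycles_le_chains k L p) i
      · obtain ⟨s', hs'⟩ | hs' := hcrit _ hBmono hBchains i
        · have h1 := (hs g hg hgf t).1 hiZ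
          have h2 := not_le.1 (mt (hs' g hg hgf t).2 hiB)
          exact ⟨Sum.inl (E.symm ⟨i, s, s', hs, hs', (hgf.lt_iff _ _).1 (h1.trans_lt h2)⟩),
            by simp [c]⟩
        · exact ⟨Sum.inr (E'.symm ⟨i, s, hs, hs'⟩), by simp [c]⟩
      · exact absurd hiZ (hs g hg hgf t)
  · congr 1
    symm
    change Multiset.map ((fun a => (J a).endpoints) ∘ finSumFinEquiv.symm) _ = _
    rw [← Multiset.map_map (fun a => (J a).endpoints) finSumFinEquiv.symm,
      Multiset.map_univ_val_equiv, ← Finset.univ_disjSum_univ, Finset.val_disjSum,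
      Multiset.disjSum, Multiset.map_add, Multiset.map_map, Multiset.map_map]
    congr 1
    · refine Multiset.map_congr rfl fun i _ => ?_
      simp [J, RealInterval.endpoints, csInf_Ico (hgστ (E i)), csSup_Ico (hgστ (E i)),
        bddAbove_Ico]
    · refine Multiset.map_congr rfl fun i _ => ?_
      simp [J, RealInterval.endpoints, not_bddAbove_Ici]

theorem existsUnique_isDgm [Finite K.faces] (f : K.faces → ℝ) (hf : IsFilterFunction f) (p : ℕ) :
    ∃! D, IsDgm k f hf p D := by
  obtain ⟨m, n, σ, τ, ρ, h⟩ := exists_simplices_isDgm k f hf p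
  exact ⟨_, h f hf fun _ _ => Iff.rfl, fun D hD => hD.unique (h f hf fun _ _ => Iff.rfl)⟩

variable {k} in
theorem IsDgm.dgm_eq {f : K.faces → ℝ} {hf : IsFilterFunction f} {p : ℕ} {D : Bar}
    (h : IsDgm k f hf p D) : Dgm k f hf p = D := by
  have hex : ∃ D, IsDgm k f hf p D := ⟨D, h⟩
  rw [Dgm, dif_pos hex]
  exact hex.choose_spec.unique h

end Diagrams

/-! ### Local constancy of the order and differentiability -/

section Differentiability

variable {V : Type v} {K : PreAbstractSimplicialComplex V} {M : Type*} [TopologicalSpace M]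

theorem isOpen_locallyConstantOrder (F : M → K.faces → ℝ) : IsOpen (locallyConstantOrder F) := by
  refine isOpen_iff_forall_mem_open.2 ?_
  rintro x ⟨W, hW, hxW, h⟩
  exact ⟨W, fun y hy => ⟨W, hW, hy, fun z hz σ τ => (h z hz σ τ).trans (h y hy σ τ).symm⟩, hW, hxW⟩

theorem dense_locallyConstantOrder [Finite K.faces] {F : M → K.faces → ℝ}
    (hF : ∀ σ, Continuous fun x => F x σ) : Dense (locallyConstantOrder F) := by
  refine dense_iff_inter_open.2 fun O hO hne => ?_
  let S : M → Set (K.faces × K.faces) := fun x => {q | F x q.1 < F x q.2}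
  -- A minimal complement is a maximal set of strict inequalities; finiteness of `K` provides one.
  obtain ⟨y, hyO, hmax⟩ := exists_minimalFor_of_wellFoundedLT (fun y => y ∈ O)
    (fun y => (S y)ᶜ) hne
  refine ⟨y, hyO, O ∩ ⋂ q ∈ S y, {z | F z q.1 < F z q.2}, hO.inter ?_, ⟨hyO, ?_⟩, ?_⟩
  · exact (Set.toFinite _).isOpen_biInter fun q _ => isOpen_lt (hF q.1) (hF q.2)
  · exact mem_iInter₂.2 fun q hq => hq
  · rintro z ⟨hzO, hz⟩ σ τ
    have h1 : S y ⊆ S z := fun q hq => mem_iInter₂.1 hz q hq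
    have h2 : S z ⊆ S y := compl_subset_compl.1 (hmax (j := z) hzO (compl_subset_compl.2 h1))
    rw [← not_lt, ← not_lt]
    exact not_congr ⟨fun h => h2 (a := (τ, σ)) h, fun h => h1 (a := (τ, σ)) h⟩

/-- The linear map that reads off the values at given simplices. -/
noncomputable def readOff {m n : ℕ} [Fintype K.faces] (σ τ : Fin m → K.faces) (ρ : Fin n → K.faces) :
    EuclideanSpace ℝ K.faces →L[ℝ] OrderedBarcode m n :=
  ((EuclideanSpace.equiv (Fin m × Fin 2) ℝ).symm.toContinuousLinearMap ∘L
    ContinuousLinearMap.pi fun q => EuclideanSpace.proj (if q.2 = 0 then σ q.1 else τ q.1)).prod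
  ((EuclideanSpace.equiv (Fin n) ℝ).symm.toContinuousLinearMap ∘L
    ContinuousLinearMap.pi fun j => EuclideanSpace.proj (ρ j))

theorem quotientMap_readOff {m n : ℕ} [Fintype K.faces] (σ τ : Fin m → K.faces)
    (ρ : Fin n → K.faces) (f : EuclideanSpace ℝ K.faces) :
    quotientMap m n (readOff σ τ ρ f) = Bar.ofMultiset
      ((Finset.univ.val.map fun i => (f (σ i), ((f (τ i) : ℝ) : WithTop ℝ))) +
        (Finset.univ.val.map fun j => (f (ρ j), (⊤ : WithTop ℝ)))) := rfl

/-- The simplices found at `x` serve for all nearby `y`, so the lift is `F` followed by a fixed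
continuous linear map. -/
theorem rDifferentiableAt_dgm (k : Type u) [Field k] [LinearOrder V] [Fintype K.faces]
    {E : Type*} [NormedAddCommGroup E] [NormedSpace ℝ E] [ChartedSpace E M]
    {F : M → EuclideanSpace ℝ K.faces} (hfilter : ∀ x, IsFilterFunction (F x)) {r : ℕ∞} {U : Set M}
    (hU : IsOpen U) (hFU : ContMDiffOn 𝓘(ℝ, E) 𝓘(ℝ, EuclideanSpace ℝ K.faces) r F U) (p : ℕ)
    {x : M} (hx : x ∈ U ∩ locallyConstantOrder fun x => F x) :
    RDifferentiableAt (E := E) r (fun y => Dgm k (F y) (hfilter y) p) x := by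
  obtain ⟨hxU, W, hW, hxW, hFW⟩ := hx
  obtain ⟨m, n, σ, τ, ρ, h⟩ := exists_simplices_isDgm k (F x) (hfilter x) p
  refine ⟨U ∩ W, hU.inter hW, ⟨hxU, hxW⟩, m, n, readOff σ τ ρ ∘ F,
    (readOff σ τ ρ).contMDiff.comp_contMDiffOn (hFU.mono inter_subset_left), fun y hy => ?_⟩
  exact (h (F y) (hfilter y) (hFW y hy.2)).dgm_eq.trans (quotientMap_readOff σ τ ρ (F y)).symm

end Differentiability

end BarcodeSmoothness

/-! ### The global smoothness theorem -/

theorem mainTheorem1 (k : Type u) [Field k]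
    {V : Type v} [LinearOrder V] (K : PreAbstractSimplicialComplex V) [Fintype K.faces]
    {E : Type*} [NormedAddCommGroup E] [NormedSpace ℝ E] [FiniteDimensional ℝ E]
    {M : Type*} [TopologicalSpace M] [ChartedSpace E M] [IsManifold 𝓘(ℝ, E) ∞ M]
    (F : M → EuclideanSpace ℝ K.faces)
    (hfilter : ∀ x, BarcodeSmoothness.IsFilterFunction (F x))
    (hF : Continuous F)
    (r : ℕ∞) (U : Set M) (hU : IsOpen U)
    (hFU : ContMDiffOn 𝓘(ℝ, E) 𝓘(ℝ, EuclideanSpace ℝ K.faces) r F U)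
    (p : ℕ) :
    -- the persistence diagrams are well defined
    (∀ x, ∃! D, BarcodeSmoothness.IsDgm k (F x) (hfilter x) p D) ∧
    IsOpen (BarcodeSmoothness.locallyConstantOrder fun x => F x) ∧
    Dense (BarcodeSmoothness.locallyConstantOrder fun x => F x) ∧
    (∀ x ∈ U ∩ BarcodeSmoothness.locallyConstantOrder (fun x => F x),
      BarcodeSmoothness.RDifferentiableAt (E := E) r
        (fun y => BarcodeSmoothness.Dgm k (F y) (hfilter y) p) x) ∧
    (Dense U → ∃ G ⊆ U, IsOpen G ∧ Dense G ∧ ∀ x ∈ G,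
      BarcodeSmoothness.RDifferentiableAt (E := E) r
        (fun y => BarcodeSmoothness.Dgm k (F y) (hfilter y) p) x) := by
  have hopen := BarcodeSmoothness.isOpen_locallyConstantOrder fun x => F x
  have hdense : Dense (BarcodeSmoothness.locallyConstantOrder fun x => F x) :=
    BarcodeSmoothness.dense_locallyConstantOrder fun σ => (EuclideanSpace.proj σ).continuous.comp hF
  have hdiff := fun x => BarcodeSmoothness.rDifferentiableAt_dgm k hfilter hU hFU p (x := x)
  exact ⟨fun x => BarcodeSmoothness.existsUnique_isDgm k _ _ p, hopen, hdense, hdiff,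
    fun hUd => ⟨_, inter_subset_left, hU.inter hopen, hUd.inter_of_isOpen_left hdense hU, hdiff⟩⟩
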